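/- Let $n\ge 3$, $0<m<\frac{n-2}{n}$ and $m\ne\frac{n-2}{n+2}$. There exist a constant $K_0$, depending only on $n$ and $m$ (hence independent of $\lambda$ and $\beta$), and constants $K(\lambda,\beta)\in\mathbb{R}$ for $\lambda,\beta>0$, such that the following holds for all $\lambda>0$, $\beta>0$. Let $v=v_{\lambda,\beta}(r)$, $r=|x|$, be the radially symmetric positive classical ($C^2$) solution of $$\frac{n-1}{m}\Delta v^m+\frac{2\beta}{1-m}v+\beta\,x\cdot\nabla v=0\quad\text{in }\mathbb{R}^n,\qquad v(0)=\lambda .$$ Then $$K(\lambda,\beta)=\lim_{s\to\infty}\left(e^{2s}v(e^s)^{1-m}-\frac{2(n-1)(n-2-nm)}{(1-m)\beta}\,s+\frac{(n-1)(n-2-(n+2)m)}{(1-m)\beta}\log s\right),$$ and, as $r\to\infty$, $$v(r)^{1-m}=\frac{2(n-1)(n-2-nm)}{(1-m)\beta r^2}\Big\{\log r-\frac{n-2-(n+2)m}{2(n-2-nm)}\log\log r+\frac{1-m}{2}\log\lambda+\frac12\log\beta+K_0+\frac{a_0(\lambda,\beta)}{\log r}+\frac{(n-2-(n+2)m)^2}{4(n-2-nm)^2}\cdot\frac{\log\log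 r}{\log r}+\frac{o(1)}{\log r}\Big\},$$ where $$a_0(\lambda,\beta)=\frac{(n-2-(n+2)m)^2}{4(n-2-nm)^2}-\frac{(1-m)^2a_1(\lambda,\beta)}{4(n-1)(n-2-nm)^2},$$ $$a_1(\lambda,\beta)=\frac{2(1-2m)(n-1)(n-2-nm)}{(1-m)^2}+\frac{(n-1)(n-2-(n+2)m)^2}{(1-m)^2}+\frac{n-2-(n+2)m}{1-m}K(\lambda,\beta)\beta .$$ Moreover, the same expansion holds with $a_0(\lambda,\beta)$ replaced by the constant $a_0(1,1)$, which is independent of $\lambda$ and $\beta$, and with the remainder $\frac{o(1)}{\log r}$ replaced by $\frac{o(\log r)}{\log r}$. -/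

import Mathlib

namespace FastDiffusion

/-- `v` is a positive classical (that is, `C^2`) solution on `ℝⁿ` of
`(n-1)/m Δ v^m + 2β/(1-m) v + β x·∇v = 0` with `v(0) = lam`. -/
structure IsSolution (n : ℕ) (m lam β : ℝ) (v : EuclideanSpace ℝ (Fin n) → ℝ) : Prop where
  contDiff : ContDiff ℝ 2 v
  pos : ∀ x, 0 < v x
  eqn : ∀ x, ((n : ℝ) - 1) / m * Laplacian.laplacian (fun y => v y ^ m) x
    + 2 * β / (1 - m) * v x + β * inner ℝ x (gradient v x) = 0
  zero : v 0 = lam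

/-- `v : ℝ → ℝ` is the radial profile of a radially symmetric solution: `x ↦ v |x|` is a solution.
Only the values of `v` on `[0, ∞)` matter. -/
def IsRadialSolution (n : ℕ) (m lam β : ℝ) (v : ℝ → ℝ) : Prop :=
  IsSolution n m lam β (fun x => v ‖x‖)

/-- `w(s) = r² v(r)^{1-m}` with `r = e^s`. -/
noncomputable def w (m : ℝ) (v : ℝ → ℝ) (s : ℝ) : ℝ :=
  Real.exp s ^ 2 * v (Real.exp s) ^ (1 - m)

/-- `h(s) = w(s) - 2(n-1)(n-2-nm)/((1-m)β) s`. -/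
noncomputable def h (n : ℕ) (m β : ℝ) (v : ℝ → ℝ) (s : ℝ) : ℝ :=
  w m v s - 2 * ((n : ℝ) - 1) * (n - 2 - n * m) / ((1 - m) * β) * s

/-- `h₁(s) = h(s) + (n-1)(n-2-(n+2)m)/((1-m)β) log s`. -/
noncomputable def h1 (n : ℕ) (m β : ℝ) (v : ℝ → ℝ) (s : ℝ) : ℝ :=
  h n m β v s + ((n : ℝ) - 1) * (n - 2 - (n + 2) * m) / ((1 - m) * β) * Real.log s

/-- The constant `a₁(lam, β)`, in terms of the function `K`. -/
noncomputable def a1 (n : ℕ) (m : ℝ) (K : ℝ → ℝ → ℝ) (lam β : ℝ) : ℝ :=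
  2 * (1 - 2 * m) * ((n : ℝ) - 1) * (n - 2 - n * m) / (1 - m) ^ 2
    + ((n : ℝ) - 1) * (n - 2 - (n + 2) * m) ^ 2 / (1 - m) ^ 2
    + ((n : ℝ) - 2 - (n + 2) * m) / (1 - m) * (K lam β * β)

/-- The constant `a₀(lam, β)`, in terms of `a₁(lam, β)`. -/
noncomputable def a0 (n : ℕ) (m : ℝ) (K : ℝ → ℝ → ℝ) (lam β : ℝ) : ℝ :=
  ((n : ℝ) - 2 - (n + 2) * m) ^ 2 / (4 * (n - 2 - n * m) ^ 2)
    - (1 - m) ^ 2 * a1 n m K lam β / (4 * ((n : ℝ) - 1) * (n - 2 - n * m) ^ 2)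

end FastDiffusion

open Filter Topology Set

/-! In the variables s = log r, w = r²v^{1-m} and z = w'/w, the radial equation becomes the
autonomous system w' = wz, z' = 2α - γz - qz² - bwz, with b = β/(n-1). The barrier z = 0 and a
growth argument force w → ∞. The z-equation is then a relaxation with rate about bw → ∞, so z
follows its quasi-equilibrium. The same relaxation principle (`tendsto_of_linear_relaxation`),
applied to wz, w(wz - a) and one further iterate, where a = 2α/b, gives w' = a - (γa/b)/w + O(w⁻²).
Integrating, w - as + (γ/b) log s converges to some K, and l'Hôpital's rule gives the next order
(`tendsto_remainder`).

The dependence on λ and β comes from uniqueness and scaling. With e^{2τ} = λ^{1-m}β, every solution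
is λ times the solution for (1,1) evaluated at e^τ r, so w is shifted by τ in s and divided by β.
Hence K(λ,β) = (k + Aτ)/β with k and A depending only on n and m, and K₀ = k/A. -/

namespace FastDiffusion

/-! ### Comparison and relaxation for scalar differential equations -/

/-- A differentiable function stays below a level at which its derivative is negative. -/
theorem le_of_deriv_neg_of_eq {f f' : ℝ → ℝ} {s₀ c : ℝ}
    (hd : ∀ s, s₀ ≤ s → HasDerivAt f (f' s) s) (h0 : f s₀ ≤ c)
    (hb : ∀ s, s₀ ≤ s → f s = c → f' s < 0) : ∀ s, s₀ ≤ s → f s ≤ c := by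
  intro s hs
  refine image_le_of_deriv_right_lt_deriv_boundary (f := f) (f' := f') (a := s₀) (b := s)
    (B := fun _ => c) (B' := fun _ => 0) ?_ ?_ h0 (fun x => hasDerivAt_const x c) ?_ ⟨hs, le_rfl⟩
  · exact fun x hx => (hd x hx.1).continuousAt.continuousWithinAt
  · exact fun x hx => (hd x hx.1).hasDerivWithinAt
  · exact fun x hx => hb x hx.1

/-- If `f' ≤ -δ` wherever `f ≥ c`, then eventually `f ≤ c`. -/
theorem eventually_le_of_deriv_le_neg {f f' : ℝ → ℝ} {S c δ : ℝ} (hδ : 0 < δ)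
    (hd : ∀ s, S ≤ s → HasDerivAt f (f' s) s)
    (hb : ∀ s, S ≤ s → c ≤ f s → f' s ≤ -δ) : ∀ᶠ s in atTop, f s ≤ c := by
  have hex : ∃ s₁, S ≤ s₁ ∧ f s₁ ≤ c := by
    by_contra! hcon
    have hbd : ∀ s, S ≤ s → f s ≤ f S - δ * (s - S) := by
      intro s hs
      refine image_le_of_deriv_right_le_deriv_boundary (f := f) (f' := f') (a := S) (b := s)
        (B := fun x => f S - δ * (x - S)) (B' := fun _ => -δ) ?_ ?_ (by simp) ?_ ?_ ?_ ⟨hs, le_rfl⟩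
      · exact fun x hx => (hd x hx.1).continuousAt.continuousWithinAt
      · exact fun x hx => (hd x hx.1).hasDerivWithinAt
      · fun_prop
      · intro x _
        have := (((hasDerivAt_id x).sub_const S).const_mul δ).const_sub (f S)
        simpa using this.hasDerivWithinAt
      · exact fun x hx => hb x hx.1 (hcon x hx.1).le
    have hS := hcon S le_rfl
    have hs : S ≤ S + (f S - c) / δ := by
      have : 0 ≤ (f S - c) / δ := div_nonneg (by linarith) hδ.le
      linarith
    have h1 := hbd _ hs
    have h2 := hcon _ hs
    have h3 : δ * (S + (f S - c) / δ - S) = f S - c := by field_simp; ring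
    linarith
  obtain ⟨s₁, hs₁, hfs⟩ := hex
  filter_upwards [eventually_ge_atTop s₁] with s hs
  exact le_of_deriv_neg_of_eq (fun t ht => hd t (hs₁.trans ht)) hfs
    (fun t ht hft => by linarith [hb t (hs₁.trans ht) hft.ge]) s hs

/-- Relaxation upper bound for `f' = k (g - f)` with `k → ∞` and `g → L`. -/
theorem eventually_le_of_relaxation {f g k : ℝ → ℝ} {L ε : ℝ} (hε : 0 < ε)
    (hd : ∀ᶠ s in atTop, HasDerivAt f (k s * (g s - f s)) s)
    (hk : Tendsto k atTop atTop) (hg : Tendsto g atTop (𝓝 L)) :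
    ∀ᶠ s in atTop, f s ≤ L + ε := by
  have h1 : ∀ᶠ s in atTop, g s < L + ε / 2 := hg.eventually_lt_const (by linarith)
  obtain ⟨S, hS⟩ := eventually_atTop.1 (hd.and (h1.and (hk.eventually_ge_atTop 1)))
  -- Where f ≥ L + ε, the gap g - f is below -ε/2 and k ≥ 1, so f decreases at rate at least ε/2.
  refine eventually_le_of_deriv_le_neg (S := S) (half_pos hε) (fun s hs => (hS s hs).1) ?_
  intro s hs hfs
  obtain ⟨-, hgs, hks⟩ := hS s hs
  nlinarith

/-- Solutions of `f' = k (g - f)` with `k → ∞` and `g → L` tend to `L`. -/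
theorem tendsto_of_relaxation {f g k : ℝ → ℝ} {L : ℝ}
    (hd : ∀ᶠ s in atTop, HasDerivAt f (k s * (g s - f s)) s)
    (hk : Tendsto k atTop atTop) (hg : Tendsto g atTop (𝓝 L)) :
    Tendsto f atTop (𝓝 L) := by
  rw [Metric.tendsto_nhds]
  intro ε hε
  have hd' : ∀ᶠ s in atTop, HasDerivAt (fun t => -f t) (k s * (-g s - -f s)) s := by
    filter_upwards [hd] with s hs
    exact hs.fun_neg.congr_deriv (by ring)
  filter_upwards [eventually_le_of_relaxation (half_pos hε) hd hk hg,
    eventually_le_of_relaxation (half_pos hε) hd' hk hg.neg] with s h1 h2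
  rw [Real.dist_eq, abs_lt]
  constructor <;> linarith

/-- Solutions of `x' = -(b w + κ) x + w g` with `w → ∞`, `κ` convergent and `g → G` tend to
`G / b`. -/
theorem tendsto_of_linear_relaxation {x w κ g : ℝ → ℝ} {b κ₀ G : ℝ} (hb : 0 < b)
    (hw : Tendsto w atTop atTop) (hκ : Tendsto κ atTop (𝓝 κ₀)) (hg : Tendsto g atTop (𝓝 G))
    (hd : ∀ᶠ s in atTop, HasDerivAt x (-(b * w s + κ s) * x s + w s * g s) s) :
    Tendsto x atTop (𝓝 (G / b)) := by
  have hk : Tendsto (fun s => b * w s + κ s) atTop atTop :=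
    (hw.const_mul_atTop hb).atTop_add hκ
  have hlim : Tendsto (fun s => g s / (b + κ s / w s)) atTop (𝓝 (G / b)) := by
    have hden : Tendsto (fun s => b + κ s / w s) atTop (𝓝 b) := by
      simpa using (hκ.div_atTop hw).const_add b
    exact hg.div hden hb.ne'
  -- Factor out the whole rate bw + κ; the moving equilibrium is then g/(b + κ/w).
  refine tendsto_of_relaxation (k := fun s => b * w s + κ s)
    (g := fun s => g s / (b + κ s / w s)) ?_ hk hlim
  filter_upwards [hd, hk.eventually_gt_atTop 0, hw.eventually_gt_atTop 0] with s hs h1 h2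
  convert hs using 1
  have h3 : b + κ s / w s = (b * w s + κ s) / w s := by field_simp
  rw [h3]
  field_simp
  ring

/-- A function whose derivative is dominated by that of a convergent monotone function
converges. -/
theorem exists_tendsto_of_abs_deriv_le {f f' g g' : ℝ → ℝ} {C l : ℝ}
    (hf : ∀ᶠ s in atTop, HasDerivAt f (f' s) s) (hg : ∀ᶠ s in atTop, HasDerivAt g (g' s) s)
    (hg' : ∀ᶠ s in atTop, 0 ≤ g' s) (hfg : ∀ᶠ s in atTop, |f' s| ≤ C * g' s)
    (hl : Tendsto g atTop (𝓝 l)) : ∃ L, Tendsto f atTop (𝓝 L) := by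
  obtain ⟨S, hS⟩ := eventually_atTop.1 (hf.and (hg.and (hg'.and hfg)))
  have hgi : MeasureTheory.IntegrableOn g' (Ioi S) :=
    MeasureTheory.integrableOn_Ioi_deriv_of_nonneg' (fun x hx => (hS x hx).2.1)
      (fun x hx => (hS x (le_of_lt hx)).2.2.1) hl
  have hfi : MeasureTheory.IntegrableOn f' (Ioi S) := by
    refine MeasureTheory.Integrable.mono' (hgi.const_mul C) ?_ ?_
    · refine (aestronglyMeasurable_deriv f _).congr ?_
      filter_upwards [MeasureTheory.ae_restrict_mem measurableSet_Ioi] with x hx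
      exact (hS x (le_of_lt hx)).1.deriv
    · filter_upwards [MeasureTheory.ae_restrict_mem measurableSet_Ioi] with x hx
      exact (hS x (le_of_lt hx)).2.2.2
  exact ⟨_, MeasureTheory.tendsto_limUnder_of_hasDerivAt_of_integrableOn_Ioi
    (fun x hx => (hS x (le_of_lt hx)).1) hfi⟩

/-! ### Asymptotics of the autonomous system -/

/-- The autonomous system satisfied by `w = r² v^{1-m}` and its logarithmic derivative `z` in the
variable `s = log r`. -/
structure IsTrajectory (α γ q b : ℝ) (w z : ℝ → ℝ) : Prop where
  α_pos : 0 < α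
  q_pos : 0 < q
  b_pos : 0 < b
  w_pos : ∀ s, 0 < w s
  z_pos : ∃ s, 0 < z s
  deriv_w : ∀ s, HasDerivAt w (w s * z s) s
  deriv_z : ∀ s, HasDerivAt z (2 * α - γ * z s - q * z s ^ 2 - b * w s * z s) s

namespace IsTrajectory

variable {α γ q b : ℝ} {w z : ℝ → ℝ}

/-- Where z = 0 the equation gives z' = 2α > 0, so z cannot cross zero downwards. -/
theorem eventually_z_nonneg (t : IsTrajectory α γ q b w z) :
    ∃ s₀, 0 < z s₀ ∧ ∀ s, s₀ ≤ s → 0 ≤ z s := by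
  obtain ⟨s₀, hs₀⟩ := t.z_pos
  refine ⟨s₀, hs₀, fun s hs => ?_⟩
  have := le_of_deriv_neg_of_eq (f := fun s => -z s) (c := 0) (s₀ := s₀)
    (fun s _ => (t.deriv_z s).fun_neg) (by linarith) ?_ s hs
  · linarith
  · intro s _ hz
    have hz0 : z s = 0 := by simpa using hz
    have := t.α_pos
    rw [hz0]
    linarith

/-- Once z ≥ 0, w is nondecreasing. If it were bounded by W, then z would stay above some δ > 0 and
w would grow at least linearly, a contradiction. -/
theorem tendsto_w (t : IsTrajectory α γ q b w z) : Tendsto w atTop atTop := by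
  obtain ⟨s₀, hz₀, hz⟩ := t.eventually_z_nonneg
  have hα := t.α_pos
  have hq := t.q_pos
  have hb := t.b_pos
  have hmono : MonotoneOn w (Ici s₀) := by
    refine monotoneOn_of_deriv_nonneg (convex_Ici s₀)
      (fun x _ => (t.deriv_w x).continuousAt.continuousWithinAt)
      (fun x _ => (t.deriv_w x).differentiableAt.differentiableWithinAt) ?_
    intro x hx
    rw [interior_Ici] at hx
    rw [(t.deriv_w x).deriv]
    exact mul_nonneg (t.w_pos x).le (hz x (le_of_lt hx))
  suffices hunb : ∀ W : ℝ, ∃ s, s₀ ≤ s ∧ W < w s by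
    rw [tendsto_atTop]
    intro W
    obtain ⟨s₁, h1, h2⟩ := hunb W
    filter_upwards [eventually_ge_atTop s₁] with s hs
    exact h2.le.trans (hmono h1 (h1.trans hs) hs)
  intro W
  by_contra! hW
  have hWpos : 0 < W := (t.w_pos s₀).trans_le (hW s₀ le_rfl)
  -- The bound on (|γ| + q + bW)δ makes z' > 0 wherever z = δ; δ ≤ 1 serves to bound δ² by δ.
  obtain ⟨δ, hδ, hδz, hδs⟩ : ∃ δ, 0 < δ ∧ δ ≤ z s₀ ∧ (|γ| + q + b * W) * δ < 2 * α ∧ δ ≤ 1 := by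
    have hc : 0 < |γ| + q + b * W := by positivity
    refine ⟨min (z s₀) (min 1 (α / (|γ| + q + b * W))), by positivity, min_le_left _ _, ?_,
      (min_le_right _ _).trans (min_le_left _ _)⟩
    calc (|γ| + q + b * W) * min (z s₀) (min 1 (α / (|γ| + q + b * W)))
        ≤ (|γ| + q + b * W) * (α / (|γ| + q + b * W)) := by
          gcongr
          exact (min_le_right _ _).trans (min_le_right _ _)
      _ = α := by field_simp
      _ < 2 * α := by linarith
  obtain ⟨hδs, hδ1⟩ := hδs
  have hzδ : ∀ s, s₀ ≤ s → δ ≤ z s := by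
    intro s hs
    have := le_of_deriv_neg_of_eq (f := fun s => -z s) (c := -δ) (s₀ := s₀)
      (fun s _ => (t.deriv_z s).fun_neg) (by linarith) ?_ s hs
    · linarith
    · intro s hs hzs
      have hz0 : z s = δ := by simpa using hzs
      rw [hz0]
      have h1 : γ * δ ≤ |γ| * δ := by gcongr; exact le_abs_self γ
      have h2 : q * δ ^ 2 ≤ q * δ := by gcongr; nlinarith
      have h3 : b * w s * δ ≤ b * W * δ := by gcongr; exact hW s hs
      linarith
  have hfin := eventually_le_of_deriv_le_neg (f := fun s => -w s) (c := -(W + 1)) (S := s₀)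
    (δ := w s₀ * δ) (mul_pos (t.w_pos s₀) hδ) (fun s _ => (t.deriv_w s).fun_neg) ?_
  · obtain ⟨s, hs, hs'⟩ := (hfin.and (eventually_ge_atTop s₀)).exists
    linarith [hW s hs']
  · intro s hs _
    exact neg_le_neg (mul_le_mul (hmono (mem_Ici.2 le_rfl) hs hs) (hzδ s hs) hδ.le (t.w_pos s).le)

/-- Written as z' = k(2α/k - z), the equation relaxes at rate k = bw + γ + qz → ∞ towards 2α/k → 0.
-/
theorem tendsto_z (t : IsTrajectory α γ q b w z) : Tendsto z atTop (𝓝 0) := by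
  obtain ⟨s₀, -, hz⟩ := t.eventually_z_nonneg
  have hk : Tendsto (fun s => b * w s + γ + q * z s) atTop atTop := by
    refine tendsto_atTop_mono' _ ?_
      (tendsto_atTop_add_const_right _ γ (t.tendsto_w.const_mul_atTop t.b_pos))
    filter_upwards [eventually_ge_atTop s₀] with s hs
    have := mul_nonneg t.q_pos.le (hz s hs)
    linarith
  refine tendsto_of_relaxation (k := fun s => b * w s + γ + q * z s)
    (g := fun s => 2 * α / (b * w s + γ + q * z s)) ?_ hk (tendsto_const_nhds.div_atTop hk)
  filter_upwards [hk.eventually_gt_atTop 0] with s hs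
  refine (t.deriv_z s).congr_deriv ?_
  rw [mul_sub, mul_div_cancel₀ _ hs.ne']
  ring

/-- `w' = w z → 2α/b`. -/
theorem tendsto_deriv_w (t : IsTrajectory α γ q b w z) :
    Tendsto (fun s => w s * z s) atTop (𝓝 (2 * α / b)) := by
  refine tendsto_of_linear_relaxation (κ := fun s => γ - (1 - q) * z s) (κ₀ := γ - (1 - q) * 0)
    (g := fun _ => 2 * α) t.b_pos t.tendsto_w (by simpa using (t.tendsto_z.const_mul (1 - q)).const_sub γ)
    tendsto_const_nhds (Eventually.of_forall fun s => ?_)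
  exact ((t.deriv_w s).mul (t.deriv_z s)).congr_deriv (by ring)

/-- The first correction: `w (w' - 2α/b) → -γ (2α/b) / b`. -/
theorem tendsto_first_correction (t : IsTrajectory α γ q b w z) :
    Tendsto (fun s => w s * (w s * z s - 2 * α / b)) atTop (𝓝 (-γ * (2 * α / b) / b)) := by
  have hb := t.b_pos.ne'
  refine tendsto_of_linear_relaxation (κ := fun s => -z s) (κ₀ := -0)
    (g := fun s => -γ * (w s * z s) + (1 - q) * (w s * z s) * z s) t.b_pos t.tendsto_w
    t.tendsto_z.neg ?_ (Eventually.of_forall fun s => ?_)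
  · simpa using (t.tendsto_deriv_w.const_mul (-γ)).add
      ((t.tendsto_deriv_w.const_mul (1 - q)).mul t.tendsto_z)
  · refine ((t.deriv_w s).mul
      (((t.deriv_w s).mul (t.deriv_z s)).sub_const (2 * α / b))).congr_deriv ?_
    simp only [Pi.mul_apply]
    field_simp
    ring

/-- The second correction. -/
theorem tendsto_second_correction (t : IsTrajectory α γ q b w z) :
    Tendsto (fun s => w s * (w s * (w s * z s - 2 * α / b) - -γ * (2 * α / b) / b)) atTop
      (𝓝 ((-γ * (-γ * (2 * α / b) / b) + (1 - q) * (2 * α / b) ^ 2) / b)) := by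
  have hb := t.b_pos.ne'
  refine tendsto_of_linear_relaxation (κ := fun s => -z s) (κ₀ := -0)
    (g := fun s => (z s - γ) * (w s * (w s * z s - 2 * α / b)) + (1 - q) * (w s * z s) ^ 2)
    t.b_pos t.tendsto_w t.tendsto_z.neg ?_ (Eventually.of_forall fun s => ?_)
  · simpa using ((t.tendsto_z.sub_const γ).mul t.tendsto_first_correction).add
      ((t.tendsto_deriv_w.pow 2).const_mul (1 - q))
  · refine ((t.deriv_w s).mul (((t.deriv_w s).mul
      (((t.deriv_w s).mul (t.deriv_z s)).sub_const (2 * α / b))).sub_const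
        (-γ * (2 * α / b) / b))).congr_deriv ?_
    simp only [Pi.mul_apply]
    field_simp
    ring

/-- Using log w in place of log s makes the 1/w term of the derivative cancel exactly. What remains
is O(w⁻²), hence dominated by a multiple of w'/w² = (-1/w)', because w' has a positive limit. -/
theorem exists_tendsto_log_w (t : IsTrajectory α γ q b w z) :
    ∃ L, Tendsto (fun s => w s - 2 * α / b * s + γ / b * Real.log (w s)) atTop (𝓝 L) := by
  have hb := t.b_pos
  have hα := t.α_pos
  have hwpos := t.w_pos
  have ha : 0 < 2 * α / b := by positivity
  set p₁ := fun s => w s * (w s * z s - 2 * α / b) with hp₁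
  set p₂ := fun s => w s * (w s * (w s * z s - 2 * α / b) - -γ * (2 * α / b) / b) with hp₂
  have hratio : Tendsto (fun s => (p₂ s + γ / b * p₁ s) / (w s * z s)) atTop _ :=
    (t.tendsto_second_correction.add (t.tendsto_first_correction.const_mul (γ / b))).div
      t.tendsto_deriv_w ha.ne'
  obtain ⟨C, hC⟩ : ∃ C, ∀ᶠ s in atTop, |(p₂ s + γ / b * p₁ s) / (w s * z s)| ≤ C :=
    ⟨_, hratio.abs.eventually_le_const (lt_add_one _)⟩
  have hu : ∀ᶠ s in atTop, 0 < w s * z s := t.tendsto_deriv_w.eventually_const_lt ha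
  refine exists_tendsto_of_abs_deriv_le (C := C) (g := fun s => -(w s)⁻¹) (l := -0)
    (f' := fun s => (p₂ s + γ / b * p₁ s) / w s ^ 2) (g' := fun s => (w s * z s) / w s ^ 2)
    (Eventually.of_forall fun s => ?_) (Eventually.of_forall fun s => ?_) ?_ ?_
    t.tendsto_w.inv_tendsto_atTop.neg
  · refine (((t.deriv_w s).fun_sub ((hasDerivAt_id s).const_mul (2 * α / b))).fun_add
      (((t.deriv_w s).log (hwpos s).ne').const_mul (γ / b))).congr_deriv ?_
    have := (hwpos s).ne'
    simp only [hp₁, hp₂]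
    field_simp
    ring
  · refine ((t.deriv_w s).fun_inv (hwpos s).ne').neg.congr_deriv ?_
    ring
  · filter_upwards [hu] with s hs
    positivity
  · filter_upwards [hC, hu] with s hs hus
    rw [abs_div, abs_of_pos hus, div_le_iff₀ hus] at hs
    rw [abs_div, abs_of_pos (pow_pos (hwpos s) 2), ← mul_div_assoc]
    exact div_le_div_of_nonneg_right hs (by positivity)

/-- Divide the preceding limit by w: both log w / w and the convergent quantity over w vanish. -/
theorem tendsto_div_w (t : IsTrajectory α γ q b w z) :
    Tendsto (fun s => s / w s) atTop (𝓝 (2 * α / b)⁻¹) := by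
  obtain ⟨L, hL⟩ := t.exists_tendsto_log_w
  have hb := t.b_pos
  have hα := t.α_pos
  have h1 : Tendsto (fun s => Real.log (w s) / w s) atTop (𝓝 0) := by
    have := Real.isLittleO_log_id_atTop.tendsto_div_nhds_zero.comp t.tendsto_w
    exact this
  have h2 := hL.div_atTop t.tendsto_w
  have h3 := ((h1.const_mul (γ / b)).const_add 1).sub h2 |>.const_mul (2 * α / b)⁻¹
  simp only [mul_zero, add_zero, sub_zero, mul_one] at h3
  refine h3.congr fun s => ?_
  have := (t.w_pos s).ne'
  field_simp
  ring

/-- Since s/w has a positive limit, log s - log w converges, so log w may be traded for log s. -/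
theorem exists_tendsto_log (t : IsTrajectory α γ q b w z) :
    ∃ K, Tendsto (fun s => w s - 2 * α / b * s + γ / b * Real.log s) atTop (𝓝 K) := by
  obtain ⟨L, hL⟩ := t.exists_tendsto_log_w
  have hb := t.b_pos
  have hα := t.α_pos
  have ha : 0 < (2 * α / b)⁻¹ := by positivity
  have h1 := (t.tendsto_div_w.log ha.ne').const_mul (γ / b)
  refine ⟨_, (hL.add h1).congr' ?_⟩
  filter_upwards [eventually_gt_atTop 0] with s hs
  rw [Real.log_div hs.ne' (t.w_pos s).ne']
  ring

/-- The second order expansion of `w`. -/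
theorem tendsto_remainder (t : IsTrajectory α γ q b w z) {K : ℝ}
    (hK : Tendsto (fun s => w s - 2 * α / b * s + γ / b * Real.log s) atTop (𝓝 K)) :
    Tendsto (fun s => s * (w s - 2 * α / b * s + γ / b * Real.log s - K)
        - γ ^ 2 / (2 * α * b) * Real.log s) atTop
      (𝓝 (-(γ * K / (2 * α) + (1 - q) / b))) := by
  have hb := t.b_pos
  have hα := t.α_pos
  have hwpos := t.w_pos
  set H := fun s => w s - 2 * α / b * s + γ / b * Real.log s with hH
  set p₂ := fun s => w s * (w s * (w s * z s - 2 * α / b) - -γ * (2 * α / b) / b) with hp₂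
  have hlogs : Tendsto (fun s => Real.log s / s) atTop (𝓝 0) :=
    Real.isLittleO_log_id_atTop.tendsto_div_nhds_zero
  have hlog2 : Tendsto (fun s => Real.log s ^ 2 / s) atTop (𝓝 0) := by
    have := (Real.isLittleO_pow_log_id_atTop (n := 2)).tendsto_div_nhds_zero
    exact this
  -- Since as - w = (γ/b) log s - H with a = 2α/b, the difference s/w - 1/a is O(log s / s), which
  -- beats the factor log s.
  have hdiff : Tendsto (fun s => Real.log s * (s / w s - (2 * α / b)⁻¹)) atTop (𝓝 0) := by
    have h1 := (((hlog2.const_mul (γ / b)).sub (hK.mul hlogs)).mul t.tendsto_div_w).const_mul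
      (2 * α / b)⁻¹
    simp only [mul_zero, sub_zero, zero_mul] at h1
    refine h1.congr' ?_
    filter_upwards [eventually_gt_atTop 0] with s hs
    have := (hwpos s).ne'
    simp only [hH]
    field_simp
    ring
  have hF : Tendsto (fun s => H s - K - γ ^ 2 / (2 * α * b) * (Real.log s / s + s⁻¹)) atTop
      (𝓝 0) := by
    simpa using (hK.sub_const K).sub
      ((hlogs.add tendsto_inv_atTop_zero).const_mul (γ ^ 2 / (2 * α * b)))
  -- L'Hôpital against 1/s. The extra s⁻¹ is chosen so that log s / s + 1/s has derivative -log s /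
  -- s²; the constant it contributes is added back in `hlim`. The logarithms cancel up to `hdiff`.
  have hquot : Tendsto (fun s => (H s - K - γ ^ 2 / (2 * α * b) * (Real.log s / s + s⁻¹)) / s⁻¹)
      atTop (𝓝 (-(γ / b * K * (2 * α / b)⁻¹ +
        (-γ * (-γ * (2 * α / b) / b) + (1 - q) * (2 * α / b) ^ 2) / b * (2 * α / b)⁻¹ ^ 2
          - γ ^ 2 / b ^ 2 * 0))) := by
    refine HasDerivAt.lhopital_zero_atTop
      (f' := fun s => w s * z s - 2 * α / b + γ / b * s⁻¹
        + γ ^ 2 / (2 * α * b) * (Real.log s / s ^ 2)) (g' := fun s => -(s ^ 2)⁻¹) ?_ ?_ ?_ hF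
      tendsto_inv_atTop_zero ?_
    · filter_upwards [eventually_gt_atTop 0] with s hs
      have h1 := ((t.deriv_w s).fun_sub ((hasDerivAt_id s).const_mul (2 * α / b))).fun_add
        ((Real.hasDerivAt_log hs.ne').const_mul (γ / b))
      have h2 := ((Real.hasDerivAt_log hs.ne').fun_div (hasDerivAt_id s) hs.ne').fun_add
        (hasDerivAt_inv hs.ne')
      refine ((h1.sub_const K).fun_sub (h2.const_mul (γ ^ 2 / (2 * α * b)))).congr_deriv ?_
      simp only [id]
      field_simp
      ring
    · filter_upwards [eventually_gt_atTop 0] with s hs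
      exact hasDerivAt_inv hs.ne'
    · filter_upwards [eventually_gt_atTop 0] with s hs
      simpa using hs.ne'
    · refine (((hK.const_mul (γ / b)).mul t.tendsto_div_w).add
        (t.tendsto_second_correction.mul (t.tendsto_div_w.pow 2)) |>.sub
          (hdiff.const_mul (γ ^ 2 / b ^ 2))).neg.congr' ?_
      filter_upwards [eventually_gt_atTop 0] with s hs
      have := (hwpos s).ne'
      simp only [hH]
      field_simp
      ring
  have hlim : Tendsto (fun s => s * (H s - K) - γ ^ 2 / (2 * α * b) * Real.log s) atTop _ :=
    (hquot.add_const (γ ^ 2 / (2 * α * b))).congr' (by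
      filter_upwards [eventually_gt_atTop 0] with s hs
      field_simp
      ring)
  convert hlim using 2
  field_simp
  ring

end IsTrajectory
-- The Laplacian of a radial function
theorem iteratedFDeriv_two_eq_of_hasDerivAt {E : Type*} [NormedAddCommGroup E] [NormedSpace ℝ E]
    {g : E → ℝ} {x v : E} {c₁ : ℝ → ℝ} {c₂ : ℝ} (hg : ContDiff ℝ 2 g)
    (h1 : ∀ᶠ t in 𝓝 0, HasDerivAt (fun t : ℝ => g (x + t • v)) (c₁ t) t)
    (h2 : HasDerivAt c₁ c₂ 0) : iteratedFDeriv ℝ 2 g x ![v, v] = c₂ := by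
  have hline : ∀ t : ℝ, HasDerivAt (fun t : ℝ => x + t • v) v t := fun t => by
    simpa using ((hasDerivAt_id t).smul_const v).const_add x
  have hg1 : Differentiable ℝ g := hg.differentiable (by norm_num)
  have hg2 : Differentiable ℝ (fderiv ℝ g) :=
    (hg.fderiv_right (m := 1) (by norm_num)).differentiable (by norm_num)
  have h3 : ∀ᶠ t in 𝓝 0, c₁ t = fderiv ℝ g (x + t • v) v := by
    filter_upwards [h1] with t ht
    exact ht.unique ((hg1 _).hasFDerivAt.comp_hasDerivAt t (hline t))
  have h4 : HasDerivAt (fun t : ℝ => fderiv ℝ g (x + t • v) v)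
      (fderiv ℝ (fderiv ℝ g) (x + (0 : ℝ) • v) v v) 0 :=
    ((hg2 _).hasFDerivAt.comp_hasDerivAt (0 : ℝ) (hline 0)).clm_apply (hasDerivAt_const _ v)
      |>.congr_deriv (by simp)
  have h5 : (fun t : ℝ => fderiv ℝ g (x + t • v) v) =ᶠ[𝓝 0] c₁ := by
    filter_upwards [h3] with t ht using ht.symm
  rw [iteratedFDeriv_two_apply, (h2.congr_of_eventuallyEq h5).unique h4]
  simp

/-- The Laplacian of a radial function. -/
theorem laplacian_radial {E : Type*} [NormedAddCommGroup E] [InnerProductSpace ℝ E]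
    [FiniteDimensional ℝ E] {n : ℕ} (e : OrthonormalBasis (Fin n) ℝ E) (i₀ : Fin n) {Q : ℝ → ℝ}
    (hQ : ContDiff ℝ 2 Q) (hg : ContDiff ℝ 2 fun y : E => Q ‖y‖) {r : ℝ} (hr : 0 < r) :
    Laplacian.laplacian (fun y : E => Q ‖y‖) (r • e i₀)
      = deriv (deriv Q) r + ((n : ℝ) - 1) / r * deriv Q r := by
  have hQ1 : ∀ t, HasDerivAt Q (deriv Q t) t := fun t =>
    (hQ.differentiable (by norm_num) t).hasDerivAt
  have hQ2 : ∀ t, HasDerivAt (deriv Q) (deriv (deriv Q) t) t := fun t =>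
    ((contDiff_succ_iff_deriv.1 (show ContDiff ℝ (1 + 1) Q from hQ)).2.2.differentiable
      (by norm_num) t).hasDerivAt
  -- Along the radial direction the function is Q(r + t); along each orthogonal one it is Q(√(r² +
  -- t²)), whose second derivative at t = 0 is Q'(r)/r.
  have hmain : ∀ i, iteratedFDeriv ℝ 2 (fun y : E => Q ‖y‖) (r • e i₀) ![e i, e i]
      = if i = i₀ then deriv (deriv Q) r else deriv Q r / r := by
    intro i
    split_ifs with hi
    · subst hi
      refine iteratedFDeriv_two_eq_of_hasDerivAt (c₁ := fun t => deriv Q (r + t)) hg ?_ ?_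
      · filter_upwards [eventually_gt_nhds (neg_lt_zero.2 hr)] with t ht
        have hev : ∀ᶠ t in 𝓝 t, Q ‖r • e i + t • e i‖ = Q (r + t) := by
          filter_upwards [eventually_gt_nhds ht] with t ht
          rw [← add_smul, norm_smul, e.norm_eq_one, mul_one, Real.norm_of_nonneg (by linarith)]
        exact (HasDerivAt.comp_const_add r t (hQ1 (r + t))).congr_of_eventuallyEq hev
      · have := HasDerivAt.comp_const_add r 0 (hQ2 (r + 0))
        simpa using this
    · have hpos : ∀ t : ℝ, 0 < r ^ 2 + t ^ 2 := fun t => by positivity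
      have hnorm : ∀ t : ℝ, ‖r • e i₀ + t • e i‖ = √(r ^ 2 + t ^ 2) := by
        intro t
        rw [norm_add_eq_sqrt_iff_real_inner_eq_zero.2, norm_smul, norm_smul, e.norm_eq_one,
          e.norm_eq_one]
        · simp [← sq]
        · rw [inner_smul_left, inner_smul_right, e.inner_eq_zero (Ne.symm hi)]
          simp
      have hs : ∀ t : ℝ, HasDerivAt (fun t : ℝ => √(r ^ 2 + t ^ 2)) (t / √(r ^ 2 + t ^ 2)) t := by
        intro t
        refine (((hasDerivAt_pow 2 t).const_add (r ^ 2)).sqrt (hpos t).ne').congr_deriv ?_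
        field_simp
        simp
      refine iteratedFDeriv_two_eq_of_hasDerivAt
        (c₁ := fun t => deriv Q √(r ^ 2 + t ^ 2) / √(r ^ 2 + t ^ 2) * t) hg ?_ ?_
      · refine Eventually.of_forall fun t => ?_
        simp only [hnorm]
        exact ((hQ1 _).comp t (hs t)).congr_deriv (by ring)
      · have h0 : √(r ^ 2 + (0 : ℝ) ^ 2) = r := by simp [hr.le]
        refine ((((hQ2 _).comp 0 (hs 0)).fun_div (hs 0) (by rw [h0]; exact hr.ne')).fun_mul
          (hasDerivAt_id 0)).congr_deriv ?_
        simp [hr.le]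
  rw [congrFun (InnerProductSpace.laplacian_eq_iteratedFDeriv_orthonormalBasis _ e) (r • e i₀)]
  simp only [hmain]
  rw [Finset.sum_ite, Finset.sum_const, Finset.sum_const, Finset.filter_eq' Finset.univ i₀,
    Finset.filter_ne' Finset.univ i₀, Finset.card_erase_of_mem (Finset.mem_univ _)]
  have hn : 1 ≤ n := i₀.pos
  simp [Nat.cast_sub hn]
  ring

/-! ### The radial equation and its uniqueness -/

/-- `l = log v` for the radial profile `v` of a solution. -/
structure IsLogProfile (n : ℕ) (m β : ℝ) (l : ℝ → ℝ) : Prop where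
  contDiff : ContDiff ℝ 2 l
  deriv_zero : deriv l 0 = 0
  eqn : ∀ r, 0 < r → deriv (deriv l) r + ((n : ℝ) - 1) / r * deriv l r + m * deriv l r ^ 2
    + 1 / ((n : ℝ) - 1) * Real.exp ((1 - m) * l r) * (2 * β / (1 - m) + β * r * deriv l r) = 0

namespace IsLogProfile

variable {n : ℕ} {m β : ℝ} {l : ℝ → ℝ}

theorem hasDerivAt (hl : IsLogProfile n m β l) (r : ℝ) : HasDerivAt l (deriv l r) r :=
  (hl.contDiff.differentiable (by norm_num) r).hasDerivAt

theorem contDiff_deriv (hl : IsLogProfile n m β l) : ContDiff ℝ 1 (deriv l) :=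
  (contDiff_succ_iff_deriv.1 (show ContDiff ℝ (1 + 1) l from hl.contDiff)).2.2

theorem hasDerivAt_deriv (hl : IsLogProfile n m β l) (r : ℝ) :
    HasDerivAt (deriv l) (deriv (deriv l) r) r :=
  (hl.contDiff_deriv.differentiable (by norm_num) r).hasDerivAt

/-- Uniqueness for the initial value problem, by an energy estimate. -/
theorem eqOn {l₁ l₂ : ℝ → ℝ} (hn : 1 ≤ n) (h1 : IsLogProfile n m β l₁)
    (h2 : IsLogProfile n m β l₂) (h0 : l₁ 0 = l₂ 0) : ∀ r, 0 ≤ r → l₁ r = l₂ r := by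
  intro R hR
  have hn' : (0 : ℝ) ≤ n - 1 := by
    have : (1 : ℝ) ≤ n := by exact_mod_cast hn
    linarith
  set Φ : ℝ × ℝ × ℝ → ℝ := fun p => m * p.2.2 ^ 2
    + 1 / ((n : ℝ) - 1) * Real.exp ((1 - m) * p.2.1) * (2 * β / (1 - m) + β * p.1 * p.2.2) with hΦ
  have hΦs : ContDiff ℝ 1 Φ := by fun_prop
  set c₁ : ℝ → ℝ × ℝ × ℝ := fun r => (r, l₁ r, deriv l₁ r) with hc₁
  set c₂ : ℝ → ℝ × ℝ × ℝ := fun r => (r, l₂ r, deriv l₂ r) with hc₂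
  have hcc₁ : Continuous c₁ := continuous_id.prodMk
    (h1.contDiff.continuous.prodMk h1.contDiff_deriv.continuous)
  have hcc₂ : Continuous c₂ := continuous_id.prodMk
    (h2.contDiff.continuous.prodMk h2.contDiff_deriv.continuous)
  obtain ⟨C, hC⟩ := (hΦs.locallyLipschitz.locallyLipschitzOn
    (s := c₁ '' Icc 0 R ∪ c₂ '' Icc 0 R)).exists_lipschitzOnWith_of_compact
      ((isCompact_Icc.image hcc₁).union (isCompact_Icc.image hcc₂))
  set D := fun r => l₁ r - l₂ r with hD
  set D' := fun r => deriv l₁ r - deriv l₂ r with hD'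
  have hlip : ∀ r ∈ Icc 0 R, |Φ (c₁ r) - Φ (c₂ r)| ≤ C * (|D r| + |D' r|) := by
    intro r hr
    have h := hC.dist_le_mul (c₁ r) (Or.inl ⟨r, hr, rfl⟩) (c₂ r) (Or.inr ⟨r, hr, rfl⟩)
    rw [Real.dist_eq] at h
    refine h.trans (mul_le_mul_of_nonneg_left ?_ C.2)
    rw [Prod.dist_eq, Prod.dist_eq]
    simp only [hc₁, hc₂, dist_self, Real.dist_eq]
    exact max_le (by positivity) (max_le (by simp [hD]) (by simp [hD']))
  -- The term 2DD' costs 1 and the Lipschitz term 2C|D'|(|D| + |D'|) costs 3C by Young's inequality.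
  -- The singular term (n-1)/r · D' enters with a favourable sign and is dropped.
  set k : ℝ := 1 + 3 * C with hk
  set E := fun r => Real.exp (-k * r) * (D r ^ 2 + D' r ^ 2) with hE
  have hdE : ∀ r, HasDerivAt E (Real.exp (-k * r) * (-k * (D r ^ 2 + D' r ^ 2) + 2 * D r * D' r
      + 2 * D' r * (deriv (deriv l₁) r - deriv (deriv l₂) r))) r := by
    intro r
    have hd1 : HasDerivAt D (D' r) r := (h1.hasDerivAt r).sub (h2.hasDerivAt r)
    have hd2 : HasDerivAt D' _ r := (h1.hasDerivAt_deriv r).sub (h2.hasDerivAt_deriv r)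
    refine ((((hasDerivAt_id r).const_mul (-k)).exp).fun_mul
      ((hd1.fun_pow 2).fun_add (hd2.fun_pow 2))).congr_deriv ?_
    simp
    ring
  have hanti : AntitoneOn E (Icc 0 R) := by
    refine antitoneOn_of_deriv_nonpos (convex_Icc 0 R)
      (fun x _ => (hdE x).continuousAt.continuousWithinAt)
      (fun x _ => (hdE x).differentiableAt.differentiableWithinAt) ?_
    intro r hr
    rw [interior_Icc] at hr
    rw [(hdE r).deriv]
    refine mul_nonpos_of_nonneg_of_nonpos (Real.exp_pos _).le ?_
    have hdd : deriv (deriv l₁) r - deriv (deriv l₂) r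
        = -(((n : ℝ) - 1) / r * D' r) - (Φ (c₁ r) - Φ (c₂ r)) := by
      have e1 := h1.eqn r hr.1
      have e2 := h2.eqn r hr.1
      simp only [hΦ, hc₁, hc₂, hD']
      linear_combination e1 - e2
    rw [hdd]
    have hL := hlip r (Ioo_subset_Icc_self hr)
    have hdiv : 0 ≤ ((n : ℝ) - 1) / r * D' r ^ 2 :=
      mul_nonneg (div_nonneg hn' hr.1.le) (sq_nonneg _)
    have hprod : -(D' r * (Φ (c₁ r) - Φ (c₂ r))) ≤ |D' r| * (C * (|D r| + |D' r|)) := by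
      refine (neg_le_abs _).trans ?_
      rw [abs_mul]
      gcongr
    have hyoung : |D' r| * |D r| ≤ (D r ^ 2 + D' r ^ 2) / 2 := by
      nlinarith [sq_nonneg (|D' r| - |D r|), sq_abs (D r), sq_abs (D' r)]
    have hCy := mul_le_mul_of_nonneg_left hyoung C.2
    have hCsq : (C : ℝ) * (|D' r| * |D' r|) = C * D' r ^ 2 := by rw [← sq, sq_abs]
    have hCD : 0 ≤ (C : ℝ) * D r ^ 2 := mul_nonneg C.2 (sq_nonneg _)
    have hsq := sq_nonneg (D r - D' r)
    simp only [hk]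
    change (C : ℝ) * _ ≤ C * _ at hCy
    nlinarith
  have hE0 : E 0 = 0 := by simp [hE, hD, hD', h0, h1.deriv_zero, h2.deriv_zero]
  have hER := hanti (left_mem_Icc.2 hR) (right_mem_Icc.2 hR) hR
  rw [hE0] at hER
  have hle : D R ^ 2 + D' R ^ 2 ≤ 0 := by
    by_contra! hcon
    exact absurd hER (not_le.2 (mul_pos (Real.exp_pos _) hcon))
  have : D R ^ 2 = 0 := le_antisymm (by nlinarith [sq_nonneg (D' R)]) (sq_nonneg _)
  have := pow_eq_zero_iff (two_ne_zero) |>.1 this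
  simp only [hD] at this
  linarith

end IsLogProfile

/-! ### From the partial differential equation to the radial one -/

/-- The logarithm of a radial profile of a solution satisfies the radial equation. -/
theorem IsRadialSolution.isLogProfile {n : ℕ} (hn : 3 ≤ n) {m lam β : ℝ} (hm : m ≠ 0)
    {v : ℝ → ℝ} (hv : IsRadialSolution n m lam β v) :
    IsLogProfile n m β (fun t => Real.log (v |t|)) := by
  have hn1 : ((n : ℝ) - 1) ≠ 0 := by
    have : (3 : ℝ) ≤ n := by exact_mod_cast hn
    linarith
  let e := EuclideanSpace.basisFun (Fin n) ℝ
  let i₀ : Fin n := ⟨0, by omega⟩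
  have hnorm : ∀ t : ℝ, ‖t • e i₀‖ = |t| := fun t => by
    rw [norm_smul, e.norm_eq_one, mul_one, Real.norm_eq_abs]
  have hvpos : ∀ t, 0 < v |t| := fun t => by
    have := hv.pos (t • e i₀)
    rwa [hnorm] at this
  have hvC : ContDiff ℝ 2 fun t => v |t| := by
    have h := hv.contDiff.comp (g := fun x : EuclideanSpace ℝ (Fin n) => v ‖x‖)
      (f := fun t : ℝ => t • e i₀) (by fun_prop)
    simpa only [Function.comp_def, hnorm] using h
  set l : ℝ → ℝ := fun t => Real.log (v |t|) with hl
  have hlC : ContDiff ℝ 2 l := hvC.log fun t => (hvpos t).ne'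
  have hexp : ∀ x : EuclideanSpace ℝ (Fin n), v ‖x‖ = Real.exp (l ‖x‖) := fun x => by
    rw [hl]
    simp only [abs_norm]
    rw [Real.exp_log (hv.pos x)]
  have hl1 : ∀ r, HasDerivAt l (deriv l r) r := fun r =>
    (hlC.differentiable (by norm_num) r).hasDerivAt
  have hl2 : ∀ r, HasDerivAt (deriv l) (deriv (deriv l) r) r := fun r =>
    ((contDiff_succ_iff_deriv.1 (show ContDiff ℝ (1 + 1) l from hlC)).2.2.differentiable
      (by norm_num) r).hasDerivAt
  refine ⟨hlC, ?_, ?_⟩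
  -- The even extension of the profile is smooth across 0, so its derivative there vanishes.
  · have h1 := deriv_comp_neg l 0
    have h2 : (fun x => l (-x)) = l := by
      funext x
      simp [hl]
    rw [h2, neg_zero] at h1
    linarith
  · intro r hr
    have hQ1 : ∀ t, HasDerivAt (fun t => Real.exp (m * l t)) (Real.exp (m * l t) * (m * deriv l t)) t :=
      fun t => ((hl1 t).const_mul m).exp
    have hQd : deriv (fun t => Real.exp (m * l t)) = fun t => Real.exp (m * l t) * (m * deriv l t) :=
      funext fun t => (hQ1 t).deriv
    have hvm : (fun y : EuclideanSpace ℝ (Fin n) => v ‖y‖ ^ m)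
        = fun y => Real.exp (m * l ‖y‖) := by
      funext y
      rw [hexp y, ← Real.exp_mul, mul_comm]
    have hlap := laplacian_radial e i₀ (Q := fun t => Real.exp (m * l t)) (by fun_prop)
      (by rw [← hvm]; exact hv.contDiff.rpow_const_of_ne fun x => (hv.pos x).ne') hr
    rw [hQd, ((hQ1 r).fun_mul ((hl2 r).const_mul m)).deriv] at hlap
    have hinner : inner ℝ (r • e i₀)
        (gradient (fun x : EuclideanSpace ℝ (Fin n) => v ‖x‖) (r • e i₀))
        = r * (Real.exp (l r) * deriv l r) := by
      rw [inner_gradient_right]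
      have hd : HasDerivAt (fun t : ℝ => v ‖t • e i₀‖)
          (fderiv ℝ (fun x : EuclideanSpace ℝ (Fin n) => v ‖x‖) (r • e i₀) (e i₀)) r := by
        have hline : HasDerivAt (fun t : ℝ => t • e i₀) (e i₀) r := by
          simpa using (hasDerivAt_id r).smul_const (e i₀)
        exact ((hv.contDiff.differentiable (by norm_num) _).hasFDerivAt).comp_hasDerivAt r hline
      have hev : (fun t : ℝ => v ‖t • e i₀‖) = fun t => Real.exp (l t) := by
        funext t
        rw [hnorm, hl]
        simp only
        rw [Real.exp_log (hvpos t)]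
      rw [hev] at hd
      rw [map_smul, hd.unique (hl1 r).exp]
      simp
    have heq := hv.eqn (r • e i₀)
    rw [hvm, hlap, hinner, hexp, hnorm, abs_of_pos hr] at heq
    -- Every term then carries the factor e^{ml}, which is cancelled together with n - 1.
    have hsplit : Real.exp (l r) = Real.exp (m * l r) * Real.exp ((1 - m) * l r) := by
      rw [← Real.exp_add]
      ring_nf
    rw [hsplit] at heq
    have hne := (Real.exp_pos (m * l r)).ne'
    refine mul_left_cancel₀ (mul_ne_zero hn1 hne) ?_
    rw [mul_zero, ← heq]
    field_simp
    ring

/-! ### Logarithmic variables, scaling and the constant K -/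

/-- `w = r² v^{1-m}` in terms of `l = log v`, as a function of `s = log r`. -/
noncomputable def logW (m : ℝ) (l : ℝ → ℝ) (s : ℝ) : ℝ :=
  Real.exp (2 * s + (1 - m) * l (Real.exp s))

theorem IsLogProfile.isTrajectory {n : ℕ} {m β : ℝ} {l : ℝ → ℝ} (hn : 3 ≤ n) (hm0 : 0 < m)
    (hm1 : m < 1) (hα : 0 < (n : ℝ) - 2 - n * m) (hβ : 0 < β) (hl : IsLogProfile n m β l) :
    IsTrajectory (((n : ℝ) - 2 - n * m) / (1 - m)) (((n : ℝ) - 2 - (n + 2) * m) / (1 - m))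
      (m / (1 - m)) (β / ((n : ℝ) - 1)) (logW m l)
      (fun s => 2 + (1 - m) * (Real.exp s * deriv l (Real.exp s))) := by
  have hn1 : 0 < (n : ℝ) - 1 := by
    have : (3 : ℝ) ≤ n := by exact_mod_cast hn
    linarith
  have hm' : 0 < 1 - m := by linarith
  refine ⟨div_pos hα hm', div_pos hm0 hm', div_pos hβ hn1, fun s => Real.exp_pos _, ?_, ?_, ?_⟩
  -- As s → -∞, r l'(r) → 0, so z → 2 and z is positive somewhere.
  · have hlim : Tendsto (fun s => 2 + (1 - m) * (Real.exp s * deriv l (Real.exp s))) atBot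
        (𝓝 (2 + (1 - m) * (0 * deriv l 0))) :=
      ((Real.tendsto_exp_atBot.mul ((hl.contDiff_deriv.continuous.tendsto 0).comp
        Real.tendsto_exp_atBot)).const_mul _).const_add _
    exact (hlim.eventually_const_lt (by norm_num)).exists
  · intro s
    have h1 := ((hl.hasDerivAt (Real.exp s)).comp s (Real.hasDerivAt_exp s)).const_mul (1 - m)
    refine (((hasDerivAt_id s).const_mul 2).fun_add h1).exp.congr_deriv ?_
    simp only [logW, id, Function.comp]
    ring
  · intro s
    have h1 := (hl.hasDerivAt_deriv (Real.exp s)).comp s (Real.hasDerivAt_exp s)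
    refine ((((Real.hasDerivAt_exp s).fun_mul h1).const_mul (1 - m)).const_add 2).congr_deriv ?_
    have hw : logW m l s = Real.exp s ^ 2 * Real.exp ((1 - m) * l (Real.exp s)) := by
      rw [logW, Real.exp_add, ← Real.exp_nat_mul]
      norm_num
    have heq := hl.eqn (Real.exp s) (Real.exp_pos s)
    rw [hw]
    simp only [Function.comp]
    have hdd : deriv (deriv l) (Real.exp s) = -(((n : ℝ) - 1) / Real.exp s * deriv l (Real.exp s)
      + m * deriv l (Real.exp s) ^ 2 + 1 / ((n : ℝ) - 1) * Real.exp ((1 - m) * l (Real.exp s))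
        * (2 * β / (1 - m) + β * Real.exp s * deriv l (Real.exp s))) := by
      linear_combination heq
    rw [hdd]
    have := (Real.exp_pos s).ne'
    field_simp
    ring

/-- Scaling reduces a profile to one with `β = 1` and `l 0 = 0`. -/
theorem IsLogProfile.scale {n : ℕ} {m lam β τ : ℝ} {l : ℝ → ℝ} (hβ : 0 < β)
    (hτ : τ = (1 - m) / 2 * Real.log lam + 1 / 2 * Real.log β) (hl : IsLogProfile n m β l) :
    IsLogProfile n m 1 fun r => l (Real.exp (-τ) * r) - Real.log lam := by
  have hd : deriv (fun r => l (Real.exp (-τ) * r) - Real.log lam)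
      = fun r => Real.exp (-τ) * deriv l (Real.exp (-τ) * r) := by
    funext r
    rw [deriv_sub_const, deriv_comp_mul_left, smul_eq_mul]
  refine ⟨by have := hl.contDiff; fun_prop, by simp [hd, hl.deriv_zero], fun r hr => ?_⟩
  have hc := Real.exp_pos (-τ)
  have hdd : deriv (fun r => Real.exp (-τ) * deriv l (Real.exp (-τ) * r)) r
      = Real.exp (-τ) * (Real.exp (-τ) * deriv (deriv l) (Real.exp (-τ) * r)) := by
    rw [deriv_const_mul_field, deriv_comp_mul_left, smul_eq_mul]
  rw [hd, hdd]
  have heq := hl.eqn (Real.exp (-τ) * r) (mul_pos hc hr)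
  -- This identity fixes τ: it amounts to e^{2τ} = λ^{1-m}β.
  have hexp : Real.exp ((1 - m) * (l (Real.exp (-τ) * r) - Real.log lam))
      = β * Real.exp (-τ) ^ 2 * Real.exp ((1 - m) * l (Real.exp (-τ) * r)) := by
    conv_rhs => rw [← Real.exp_log hβ]
    rw [← Real.exp_nat_mul, ← Real.exp_add, ← Real.exp_add, hτ]
    congr 1
    push_cast
    ring
  rw [hexp, ← mul_zero (Real.exp (-τ) ^ 2), ← heq]
  field_simp

/-- By uniqueness there is at most one normalized profile on [0, ∞), so its limit k depends only on
n and m. -/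
theorem exists_limit_normalized {n : ℕ} (hn : 3 ≤ n) {m : ℝ} (hm0 : 0 < m) (hm1 : m < 1)
    (hα : 0 < (n : ℝ) - 2 - n * m) : ∃ k, ∀ l, IsLogProfile n m 1 l → l 0 = 0 →
      Tendsto (fun s => logW m l s
        - 2 * (((n : ℝ) - 2 - n * m) / (1 - m)) / (1 / ((n : ℝ) - 1)) * s
        + ((n : ℝ) - 2 - (n + 2) * m) / (1 - m) / (1 / ((n : ℝ) - 1)) * Real.log s)
          atTop (𝓝 k) := by
  by_cases hex : ∃ l, IsLogProfile n m 1 l ∧ l 0 = 0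
  · obtain ⟨l₁, hl₁, h0⟩ := hex
    obtain ⟨k, hk⟩ := (hl₁.isTrajectory hn hm0 hm1 hα one_pos).exists_tendsto_log
    refine ⟨k, fun l hl hl0 => ?_⟩
    have hW : logW m l = logW m l₁ := by
      funext s
      rw [logW, logW, hl.eqOn (by omega) hl₁ (hl0.trans h0.symm) _ (Real.exp_pos s).le]
    rw [hW]
    exact hk
  -- Existence of a profile is not needed: without one, any value of k serves.
  · exact ⟨0, fun l hl hl0 => absurd ⟨l, hl, hl0⟩ hex⟩

/-- The rescaled w at s + τ is β times the original w at s. The shift contributes a multiple of τ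
through the linear term, while log(s + τ) - log s → 0. -/
theorem IsLogProfile.tendsto_of_normalized {n : ℕ} {m lam β τ k : ℝ} {l : ℝ → ℝ} (hn : 3 ≤ n)
    (hβ : 0 < β)
    (hτ : τ = (1 - m) / 2 * Real.log lam + 1 / 2 * Real.log β) (hl : IsLogProfile n m β l)
    (hl0 : l 0 = Real.log lam)
    (hk : ∀ l, IsLogProfile n m 1 l → l 0 = 0 → Tendsto (fun s => logW m l s
        - 2 * (((n : ℝ) - 2 - n * m) / (1 - m)) / (1 / ((n : ℝ) - 1)) * s
        + ((n : ℝ) - 2 - (n + 2) * m) / (1 - m) / (1 / ((n : ℝ) - 1)) * Real.log s)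
          atTop (𝓝 k)) :
    Tendsto (fun s => logW m l s
        - 2 * (((n : ℝ) - 2 - n * m) / (1 - m)) / (β / ((n : ℝ) - 1)) * s
        + ((n : ℝ) - 2 - (n + 2) * m) / (1 - m) / (β / ((n : ℝ) - 1)) * Real.log s)
          atTop (𝓝 ((k + 2 * (((n : ℝ) - 2 - n * m) / (1 - m)) * ((n : ℝ) - 1) * τ) / β)) := by
  have hn1 : ((n : ℝ) - 1) ≠ 0 := by
    have : (3 : ℝ) ≤ n := by exact_mod_cast hn
    linarith
  have h1 := (hk _ (hl.scale hβ hτ) (by simp [hl0])).comp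
    (tendsto_atTop_add_const_right atTop τ tendsto_id)
  have h2 := (Real.tendsto_log_comp_add_sub_log τ).const_mul
    (((n : ℝ) - 2 - (n + 2) * m) / (1 - m) * ((n : ℝ) - 1))
  have h3 := ((h1.sub h2).add_const
    (2 * (((n : ℝ) - 2 - n * m) / (1 - m)) * ((n : ℝ) - 1) * τ)).div_const β
  rw [mul_zero, sub_zero] at h3
  refine h3.congr fun s => ?_
  have hW : logW m (fun r => l (Real.exp (-τ) * r) - Real.log lam) (s + τ) = β * logW m l s := by
    rw [logW, logW]
    conv_rhs => rw [← Real.exp_log hβ]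
    rw [← Real.exp_add, ← Real.exp_add, neg_add_cancel_comm_assoc, hτ]
    congr 1
    ring
  simp only [Function.comp, id]
  rw [hW]
  generalize ((n : ℝ) - 2 - n * m) / (1 - m) = A
  generalize ((n : ℝ) - 2 - (n + 2) * m) / (1 - m) = G
  field_simp
  ring

end FastDiffusion

/-! ### The expansion of the solution -/

theorem theorem1p1 (n : ℕ) (hn : 3 ≤ n) (m : ℝ) (hm0 : 0 < m)
    (hm1 : m < ((n : ℝ) - 2) / n) (hm2 : m ≠ ((n : ℝ) - 2) / (n + 2)) :
    ∃ (K₀ : ℝ) (K : ℝ → ℝ → ℝ), ∀ lam β : ℝ, 0 < lam → 0 < β →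
      ∀ v : ℝ → ℝ, FastDiffusion.IsRadialSolution n m lam β v →
        Filter.Tendsto (FastDiffusion.h1 n m β v) Filter.atTop (nhds (K lam β)) ∧
        (∃ ε : ℝ → ℝ, Filter.Tendsto ε Filter.atTop (nhds 0) ∧ ∀ r : ℝ, 1 < r →
          v r ^ (1 - m) = 2 * ((n : ℝ) - 1) * (n - 2 - n * m) / ((1 - m) * β * r ^ 2) *
            (Real.log r
              - ((n : ℝ) - 2 - (n + 2) * m) / (2 * (n - 2 - n * m)) * Real.log (Real.log r)
              + (1 - m) / 2 * Real.log lam + 1 / 2 * Real.log β + K₀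
              + FastDiffusion.a0 n m K lam β / Real.log r
              + ((n : ℝ) - 2 - (n + 2) * m) ^ 2 / (4 * (n - 2 - n * m) ^ 2)
                  * (Real.log (Real.log r) / Real.log r)
              + ε r / Real.log r)) ∧
        (∃ g : ℝ → ℝ, g =o[Filter.atTop] Real.log ∧ ∀ r : ℝ, 1 < r →
          v r ^ (1 - m) = 2 * ((n : ℝ) - 1) * (n - 2 - n * m) / ((1 - m) * β * r ^ 2) *
            (Real.log r
              - ((n : ℝ) - 2 - (n + 2) * m) / (2 * (n - 2 - n * m)) * Real.log (Real.log r)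
              + (1 - m) / 2 * Real.log lam + 1 / 2 * Real.log β + K₀
              + FastDiffusion.a0 n m K 1 1 / Real.log r
              + ((n : ℝ) - 2 - (n + 2) * m) ^ 2 / (4 * (n - 2 - n * m) ^ 2)
                  * (Real.log (Real.log r) / Real.log r)
              + g r / Real.log r)) := by
  have hn3 : (3 : ℝ) ≤ n := by exact_mod_cast hn
  have hn1 : 0 < (n : ℝ) - 1 := by linarith
  have hα : 0 < (n : ℝ) - 2 - n * m := by
    rw [lt_div_iff₀ (by linarith)] at hm1
    linarith
  have hm : 0 < 1 - m := by nlinarith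
  obtain ⟨k, hk⟩ := FastDiffusion.exists_limit_normalized hn hm0 (by linarith) hα
  set A := 2 * (((n : ℝ) - 2 - n * m) / (1 - m)) * ((n : ℝ) - 1) with hA
  have hApos : 0 < A := by positivity
  set K : ℝ → ℝ → ℝ := fun lam β =>
    (k + A * ((1 - m) / 2 * Real.log lam + 1 / 2 * Real.log β)) / β with hK
  refine ⟨k / A, K, fun lam β hlam hβ v hv => ?_⟩
  set l : ℝ → ℝ := fun t => Real.log (v |t|) with hl
  have hlp : FastDiffusion.IsLogProfile n m β l := hv.isLogProfile hn hm0.ne'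
  have hl0 : l 0 = Real.log lam := by
    have := hv.zero
    simp only [norm_zero] at this
    simp [hl, this]
  have hlim := hlp.tendsto_of_normalized hn hβ rfl hl0 hk
  have hrem := (hlp.isTrajectory hn hm0 (by linarith) hα hβ).tendsto_remainder hlim
  have hvpos : ∀ r, 0 < r → 0 < v r := fun r hr => by
    have := hv.pos (r • EuclideanSpace.basisFun (Fin n) ℝ ⟨0, by omega⟩)
    rwa [norm_smul, OrthonormalBasis.norm_eq_one, mul_one, Real.norm_of_nonneg hr.le] at this
  have hW : ∀ r, 0 < r → FastDiffusion.logW m l (Real.log r) = r ^ 2 * v r ^ (1 - m) := by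
    intro r hr
    rw [FastDiffusion.logW, Real.exp_log hr, Real.exp_add, hl, Real.rpow_def_of_pos (hvpos r hr)]
    simp only [abs_of_pos hr]
    rw [mul_comm (Real.log (v r)), two_mul, Real.exp_add, Real.exp_log hr, sq]
  have hw : ∀ s, FastDiffusion.w m v s = FastDiffusion.logW m l s := by
    intro s
    have := hW (Real.exp s) (Real.exp_pos s)
    rw [Real.log_exp] at this
    rw [this, FastDiffusion.w]
  set rest : ℝ → ℝ := fun r => Real.log r
    - ((n : ℝ) - 2 - (n + 2) * m) / (2 * (n - 2 - n * m)) * Real.log (Real.log r)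
    + (1 - m) / 2 * Real.log lam + 1 / 2 * Real.log β + k / A
    + FastDiffusion.a0 n m K lam β / Real.log r
    + ((n : ℝ) - 2 - (n + 2) * m) ^ 2 / (4 * (n - 2 - n * m) ^ 2)
        * (Real.log (Real.log r) / Real.log r) with hrest
  -- Defined as the exact remainder, so that the expansion is an identity and only ε → 0 has
  -- content.
  set ε : ℝ → ℝ := fun r =>
    Real.log r * (β / A * (r ^ 2 * v r ^ (1 - m)) - rest r) with hε
  have hformula : ∀ r, 1 < r →
      v r ^ (1 - m) = 2 * ((n : ℝ) - 1) * (n - 2 - n * m) / ((1 - m) * β * r ^ 2) *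
        (rest r + ε r / Real.log r) := by
    intro r hr
    have hlog := (Real.log_pos hr).ne'
    have hr0 : 0 < r := by linarith
    rw [hε]
    simp only
    rw [mul_div_cancel_left₀ _ hlog, add_sub_cancel, hA]
    generalize (n : ℝ) - 2 - n * m = d at hα ⊢
    field_simp
  have hεlim : Tendsto ε atTop (𝓝 0) := by
    have h1 := ((hrem.const_mul (β / A)).sub_const (FastDiffusion.a0 n m K lam β)).comp
      Real.tendsto_log_atTop
    -- The squared term of `a1` cancels the one in `a0`; what is left of `a0` is β/A times the limit
    -- in `tendsto_remainder`.
    have hzero : β / A * -(((n : ℝ) - 2 - (n + 2) * m) / (1 - m) *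
        ((k + A * ((1 - m) / 2 * Real.log lam + 1 / 2 * Real.log β)) / β)
          / (2 * (((n : ℝ) - 2 - n * m) / (1 - m)))
        + (1 - m / (1 - m)) / (β / ((n : ℝ) - 1))) - FastDiffusion.a0 n m K lam β = 0 := by
      rw [FastDiffusion.a0, FastDiffusion.a1]
      simp only [hK]
      generalize (k + A * ((1 - m) / 2 * Real.log lam + 1 / 2 * Real.log β)) = X
      rw [hA]
      field_simp
      ring
    rw [hzero] at h1
    refine h1.congr' ?_
    filter_upwards [eventually_gt_atTop 1] with r hr
    have hlog := (Real.log_pos hr).ne'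
    have hr0 : 0 < r := by linarith
    simp only [Function.comp, hε, hrest]
    rw [hW r hr0]
    generalize FastDiffusion.a0 n m K lam β = a
    generalize r ^ 2 * v r ^ (1 - m) = Y
    generalize Real.log (Real.log r) = LL
    generalize Real.log r = L at *
    generalize Real.log lam = L₁
    generalize Real.log β = L₂
    rw [hA]
    field_simp
    ring
  -- Replacing a₀(λ,β) by a₀(1,1) only adds a constant to ε, and a bounded remainder is o(log r).
  refine ⟨?_, ⟨ε, hεlim, hformula⟩, ⟨fun r => ε r + (FastDiffusion.a0 n m K lam β
    - FastDiffusion.a0 n m K 1 1), ?_, ?_⟩⟩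
  · refine hlim.congr fun s => ?_
    rw [FastDiffusion.h1, FastDiffusion.h, hw]
    field_simp
  · exact ((hεlim.add_const _).isBigO_one ℝ).trans_isLittleO Real.isLittleO_const_log_atTop
  · intro r hr
    rw [hformula r hr, hrest]
    ring
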